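/- **Setting.** Let $\mathcal{Y},\mathcal{X}$ be finite sets, let $(\mathcal{Y},\mathcal{E})$, $\mathcal{E}\subseteq\mathcal{Y}^2$, be a strongly connected digraph, and let $\kappa\colon\mathcal{Y}\to\mathcal{X}$ be surjective. Write $\mathcal{S}_x=\kappa^{-1}(x)$ and $\mathcal{D}=\{(\kappa(y),\kappa(y')) : (y,y')\in\mathcal{E}\}$. $\mathcal{W}(\mathcal{Y},\mathcal{E})$ denotes the set of row-stochastic matrices $P$ on $\mathcal{Y}$ with $P(y,y')>0$ if and only if $(y,y')\in\mathcal{E}$. Such a $P$ is *$\kappa$-lumpable* if there is a stochastic matrix $Q$ on $\mathcal{X}$ such that, for every initial distribution of the Markov chain $(Y_t)$ with transition matrix $P$, the process $(\kappa(Y_t))$ is a time-homogeneous Markov chain with transition matrix $Q$. $\mathcal{W}_\kappa(\mathcal{Y},\mathcal{E})$ denotes the set of $\kappa$-lumpable $P\in\mathcal{W}(\mathcal{Y},\mathcal{E})$. For a function $F\colon\mathcal{Y}^2\to[0,\infty)$ that is positive exactly on $\mathcal{E}$, let $\rho_F$ and $v_F>0$ be the Perron–Frobenius root and right eigenvector of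 the matrix $F$, and put $\mathfrak{s}(F)(y,y')=\dfrac{F(y,y')\,v_F(y')}{\rho_F\,v_F(y)}$. Let $\mathcal{N}(\mathcal{Y},\mathcal{E})\subseteq\mathbb{R}^{\mathcal{E}}$ be the subspace of the functions $(y,y')\mapsto f(y')-f(y)+c$ with $f\in\mathbb{R}^{\mathcal{Y}}$, $c\in\mathbb{R}$. A set $\mathcal{V}\subseteq\mathcal{W}(\mathcal{Y},\mathcal{E})$ *forms an e-family* if there are $d\in\mathbb{N}$, $K\in\mathbb{R}^{\mathcal{E}}$ and $G_1,\dots,G_d\in\mathbb{R}^{\mathcal{E}}$, linearly independent in $\mathbb{R}^{\mathcal{E}}/\mathcal{N}(\mathcal{Y},\mathcal{E})$, such that $$\mathcal{V}=\Big\{\mathfrak{s}\Big(\exp\Big(K+\sum_{i=1}^d\theta^iG_i\Big)\Big) : \theta\in\mathbb{R}^d\Big\},$$ where $\exp$ is taken entrywise on $\mathcal{E}$ (and the matrix is $0$ off $\mathcal{E}$). For $(x,x')\in\mathcal{D}$ let $$\mathcal{M}_{x,x'}=\{y\in\mathcal{S}_x : \exists\, y_1'\neq y_2' \text{ in } \mathcal{S}_{x'}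 \text{ with } (y,y_1'),(y,y_2')\in\mathcal{E}\},$$ and let $$\mathcal{M}=\{(x,x')\in\mathcal{D} : \mathcal{M}_{x,x'}\neq\emptyset\},\qquad \mathcal{U}=\{(x,x')\in\mathcal{D} : \mathcal{M}_{x,x'}\neq\mathcal{S}_x\},$$ $$\mathcal{R}=\bigcup_{(x,x')\in\mathcal{M}}\{(y,y')\in\mathcal{M}_{x,x'}\times\mathcal{S}_{x'} : (y,y')\in\mathcal{E}\}.$$ **Corollary (simplified dimensional criterion).** If $$\sum_{(x,x')\in\mathcal{D}}|\mathcal{S}_x| \;>\; \big(|\mathcal{D}|-|\mathcal{U}|\big)+\big(|\mathcal{Y}|-|\mathcal{X}|\big)+\big(|\mathcal{E}|-|\mathcal{R}|\big),$$ then $\mathcal{W}_\kappa(\mathcal{Y},\mathcal{E})$ does not form an e-family. -/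

import Mathlib

open scoped Matrix

noncomputable section

namespace Lumping

variable {Y X : Type*} [Fintype Y] [DecidableEq Y] [Fintype X] [DecidableEq X]

/-! ### Digraphs, edge functions, stochastic matrices -/

/-- The digraph `(Y, E)` is strongly connected: every vertex is reachable from every other one
by following edges in their direction. -/
def StronglyConnected (E : Finset (Y × Y)) : Prop :=
  ∀ y y' : Y, Relation.ReflTransGen (fun a b => (a, b) ∈ E) y y'

/-- `F(Y, E)`, the real functions on the edge set. -/
abbrev EdgeFun (E : Finset (Y × Y)) : Type _ := E → ℝ

/-- The entrywise exponential of an edge function, written as a matrix which is zero off `E`. -/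
def expMatrix (E : Finset (Y × Y)) (H : EdgeFun E) : Matrix Y Y ℝ :=
  fun y y' => if h : (y, y') ∈ E then Real.exp (H ⟨(y, y'), h⟩) else 0

/-- `W(Y, E)`, the row-stochastic matrices with connection graph `(Y, E)`: the entry at `(y, y')`
is positive if and only if `(y, y')` is an edge. (For a strongly connected digraph these
matrices are irreducible.) -/
def stochasticMatrices (E : Finset (Y × Y)) : Set (Matrix Y Y ℝ) :=
  {P | P ∈ Matrix.rowStochastic ℝ Y ∧ ∀ y y' : Y, 0 < P y y' ↔ (y, y') ∈ E}

/-! ### Lumpability -/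

/-- The block `S_x`, the preimage of `x` under `κ`. -/
def fiber (κ : Y → X) (x : X) : Finset Y := Finset.univ.filter fun y => κ y = x

/-- The probability that the Markov chain with initial distribution `μ` and transition matrix `P`
follows the path `y 0, y 1, …, y n`. -/
def pathProb (μ : Y → ℝ) (P : Matrix Y Y ℝ) {n : ℕ} (y : Fin (n + 1) → Y) : ℝ :=
  μ (y 0) * ∏ i : Fin n, P (y i.castSucc) (y i.succ)

/-- The probability that the lumped process `κ (Y_t)` of that chain follows the path
`x 0, x 1, …, x n`. -/
def lumpedPathProb (κ : Y → X) (μ : Y → ℝ) (P : Matrix Y Y ℝ) {n : ℕ} (x : Fin (n + 1) → X) : ℝ :=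
  ∑ y ∈ Finset.univ.filter (fun y : Fin (n + 1) → Y => ∀ i, κ (y i) = x i), pathProb μ P y

/-- `P` is `κ`-lumpable: there is a stochastic matrix `Q` on `X` such that, for every initial
distribution `μ` of the chain `Y_t` with transition matrix `P`, the process `κ (Y_t)` is a
time-homogeneous Markov chain with transition matrix `Q` (and, necessarily, with the image of `μ`
under `κ` as its initial distribution). -/
def IsLumpable (κ : Y → X) (P : Matrix Y Y ℝ) : Prop :=
  ∃ Q ∈ Matrix.rowStochastic ℝ X, ∀ μ ∈ stdSimplex ℝ Y, ∀ (n : ℕ) (x : Fin (n + 1) → X),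
    lumpedPathProb κ μ P x = pathProb (fun a => ∑ y ∈ fiber κ a, μ y) Q x

/-- `W_κ(Y, E)`, the `κ`-lumpable stochastic matrices with connection graph `(Y, E)`. -/
def lumpableMatrices (κ : Y → X) (E : Finset (Y × Y)) : Set (Matrix Y Y ℝ) :=
  {P | P ∈ stochasticMatrices E ∧ IsLumpable κ P}

/-! ### Exponential families of stochastic matrices -/

/-- `ρ` and `v` are the Perron–Frobenius root (the largest modulus of an eigenvalue) and an
associated positive right eigenvector of the matrix `F`. -/
structure IsPFPair (F : Matrix Y Y ℝ) (ρ : ℝ) (v : Y → ℝ) : Prop where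
  pos : ∀ y, 0 < v y
  eigen : F *ᵥ v = ρ • v
  dominant : ∀ z : ℂ, Module.End.HasEigenvalue (Matrix.toLin' (F.map Complex.ofReal)) z → ‖z‖ ≤ ρ

open Classical in
/-- The normalization `s`, which maps `F` to the matrix `F(y, y') v(y') / (ρ v(y))`, where
`(ρ, v)` is the Perron–Frobenius pair of `F`. The pair exists, and `v` is unique up to scaling,
whenever `F` is nonnegative and irreducible; the value `0` is used only when no pair exists. -/
def sNormalize (F : Matrix Y Y ℝ) : Matrix Y Y ℝ :=
  if h : ∃ p : ℝ × (Y → ℝ), IsPFPair F p.1 p.2 then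
    fun y y' => F y y' * h.choose.2 y' / (h.choose.1 * h.choose.2 y)
  else 0

/-- `N(Y, E)`, the edge functions of the form `f(y') - f(y) + c`. -/
def shiftSpace (E : Finset (Y × Y)) : Submodule ℝ (EdgeFun E) where
  carrier := {N | ∃ (c : ℝ) (f : Y → ℝ), ∀ e : E, N e = f e.1.2 - f e.1.1 + c}
  zero_mem' := ⟨0, 0, fun e => by simp⟩
  add_mem' := by
    rintro _ _ ⟨c, f, hf⟩ ⟨c', f', hf'⟩
    exact ⟨c + c', f + f', fun e => by simp only [Pi.add_apply, hf, hf']; ring⟩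
  smul_mem' := by
    rintro r _ ⟨c, f, hf⟩
    exact ⟨r * c, r • f, fun e => by simp only [Pi.smul_apply, smul_eq_mul, hf]; ring⟩

/-- A set `V` of stochastic matrices with connection graph `(Y, E)` forms an e-family:
`V = {s(exp(K + ∑ i, θ i • G i)) : θ ∈ ℝ^d}` for some dimension `d`, some edge function `K` and
some edge functions `G 1, …, G d` which are linearly independent in `F(Y, E) / N(Y, E)`. -/
def IsEFamily (E : Finset (Y × Y)) (V : Set (Matrix Y Y ℝ)) : Prop :=
  V ⊆ stochasticMatrices E ∧
    ∃ (d : ℕ) (K : EdgeFun E) (G : Fin d → EdgeFun E),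
      LinearIndependent ℝ (fun i => (shiftSpace E).mkQ (G i)) ∧
      V = Set.range fun θ : Fin d → ℝ => sNormalize (expMatrix E (K + ∑ i, θ i • G i))

/-! ### Combinatorics of the blocks -/

/-- `D = κ(E)`, the lumped edge set. -/
def lumpedEdges (κ : Y → X) (E : Finset (Y × Y)) : Finset (X × X) :=
  E.image fun e => (κ e.1, κ e.2)

/-- `M_{x,x'}`, the merging rows of the block `b = (x, x')`: the `y ∈ S_x` with edges to two
distinct elements of `S_{x'}`. -/
def mergingRows (κ : Y → X) (E : Finset (Y × Y)) (b : X × X) : Finset Y :=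
  (fiber κ b.1).filter fun y =>
    ∃ y₁ ∈ fiber κ b.2, ∃ y₂ ∈ fiber κ b.2, y₁ ≠ y₂ ∧ (y, y₁) ∈ E ∧ (y, y₂) ∈ E

/-- `M`, the merging blocks. -/
def mergingBlocks (κ : Y → X) (E : Finset (Y × Y)) : Finset (X × X) :=
  (lumpedEdges κ E).filter fun b => mergingRows κ E b ≠ ∅

/-- `U`, the blocks with at least one non-merging row. -/
def nonFullyMergingBlocks (κ : Y → X) (E : Finset (Y × Y)) : Finset (X × X) :=
  (lumpedEdges κ E).filter fun b => mergingRows κ E b ≠ fiber κ b.1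

/-- `R`, the edges which lie in a merging row of some merging block. -/
def mergingEdges (κ : Y → X) (E : Finset (Y × Y)) : Finset (Y × Y) :=
  (mergingBlocks κ E).biUnion fun b =>
    (mergingRows κ E b ×ˢ fiber κ b.2).filter fun e => e ∈ E

end Lumping

end

set_option linter.unusedSectionVars false

namespace Lumping

variable {Y X : Type*} [Fintype Y] [DecidableEq Y] [Fintype X] [DecidableEq X]

/-! Suppose the lumpable matrices form an e-family with directions `G` in dimension `d`. The proof
bounds `d` from both sides.

From above: a matrix in W(Y, E) is lumpable exactly when its block row sums depend only on the
blocks (`mem_lumpableMatrices_iff`). The pairs (P, Q) thus lie in an affine space whose direction is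
the kernel of `lumpingConstraints`, of dimension |E| + |D| - ∑|S_x| - |X|
(`finrank_ker_lumpingConstraints`). Taking logarithms and reading off the parameter is a C¹ map from
a convex part of that kernel onto ℝ^d, so `d` is at most this dimension
(`le_finrank_ker_lumpingConstraints`).

From below: W = span G + N(Y, E) contains all differences of logarithms of lumpable matrices and has
dimension at most d + |Y|. Moving mass between two edges of a merging row, or between two blocks of
a lumped row, preserves lumpability; hence W contains the indicator of each merging edge and, with
the help of N(Y, E), of each block (`single_mem_of_mem_mergingEdges`, `blockIndicator_mem`). This
gives |R| + |U| ≤ dim W (`card_le_finrank`).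

Together the bounds contradict the assumed inequality. -/

/-! ### Lumpability as a condition on block row sums -/

/-- The row sums of `P` over the blocks of `κ` are given by `Q`. -/
def HasBlockSums (κ : Y → X) (P : Matrix Y Y ℝ) (Q : Matrix X X ℝ) : Prop :=
  ∀ y x', ∑ y' ∈ fiber κ x', P y y' = Q (κ y) x'

theorem mem_fiber {κ : Y → X} {x : X} {y : Y} : y ∈ fiber κ x ↔ κ y = x := by
  simp [fiber]

theorem lumpedPathProb_zero (κ : Y → X) (μ : Y → ℝ) (P : Matrix Y Y ℝ) (x : Fin 1 → X) :
    lumpedPathProb κ μ P x = ∑ y ∈ fiber κ (x 0), μ y := by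
  simp only [lumpedPathProb, pathProb, fiber, Finset.sum_filter]
  rw [← (Equiv.funUnique (Fin 1) Y).symm.sum_comp]
  simp

/-- Summing over the last state first leaves a block row sum, which depends on the previous state
only through its block and so factors out. -/
theorem lumpedPathProb_succ {κ : Y → X} {P : Matrix Y Y ℝ} {Q : Matrix X X ℝ}
    (h : HasBlockSums κ P Q) (μ : Y → ℝ) {n : ℕ} (x : Fin (n + 2) → X) :
    lumpedPathProb κ μ P x = lumpedPathProb κ μ P (fun i : Fin (n + 1) => x i.castSucc) *
      Q (x (Fin.last n).castSucc) (x (Fin.last (n + 1))) := by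
  simp only [lumpedPathProb, Finset.sum_filter, Finset.sum_mul]
  rw [← (Fin.snocEquiv (fun _ : Fin (n + 2) => Y)).sum_comp, Fintype.sum_prod_type_right]
  refine Finset.sum_congr rfl fun y _ => ?_
  by_cases hy : ∀ i, κ (y i) = x i.castSucc
  · rw [if_pos hy, ← hy (Fin.last n), ← h, Finset.mul_sum, fiber, Finset.sum_filter]
    refine Finset.sum_congr rfl fun z _ => ?_
    have : (∀ i, κ (Fin.snocEquiv (fun _ : Fin (n + 2) => Y) (z, y) i) = x i) ↔
        κ z = x (Fin.last (n + 1)) := by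
      rw [Fin.forall_fin_succ']
      simp [Fin.snocEquiv, hy]
    simp only [this]
    refine if_congr Iff.rfl ?_ rfl
    rw [pathProb, pathProb, Fin.prod_univ_castSucc, mul_assoc]
    have h0 : (0 : Fin (n + 2)) = (0 : Fin (n + 1)).castSucc := rfl
    simp only [Fin.snocEquiv, Equiv.coe_fn_mk, h0, Fin.snoc_castSucc, ← Fin.castSucc_succ,
      Fin.succ_last, Fin.snoc_last]
  · rw [if_neg hy, zero_mul]
    refine Finset.sum_eq_zero fun z _ => if_neg fun hz => hy fun i => ?_
    simpa [Fin.snocEquiv] using hz i.castSucc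

theorem lumpedPathProb_eq {κ : Y → X} {P : Matrix Y Y ℝ} {Q : Matrix X X ℝ}
    (h : HasBlockSums κ P Q) (μ : Y → ℝ) {n : ℕ} (x : Fin (n + 1) → X) :
    lumpedPathProb κ μ P x = pathProb (fun a => ∑ y ∈ fiber κ a, μ y) Q x := by
  induction n with
  | zero => simp [lumpedPathProb_zero, pathProb]
  | succ n ih =>
    rw [lumpedPathProb_succ h, ih]
    simp only [pathProb]
    rw [Fin.prod_univ_castSucc (n := n), mul_assoc]
    rfl

/-- Point masses as initial distributions and paths of one step already force the block sums. -/
theorem IsLumpable.exists_hasBlockSums {κ : Y → X} {P : Matrix Y Y ℝ} (h : IsLumpable κ P) :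
    ∃ Q : Matrix X X ℝ, HasBlockSums κ P Q := by
  obtain ⟨Q, -, hQ⟩ := h
  refine ⟨Q, fun y x' => ?_⟩
  have := hQ (Pi.single y 1) (single_mem_stdSimplex ℝ y) 1 ![κ y, x']
  have e1 : ∑ z ∈ fiber κ (κ y), (Pi.single y 1 : Y → ℝ) z = 1 := by
    simp [mem_fiber, Finset.sum_pi_single']
  simp only [pathProb, lumpedPathProb] at this
  rw [Finset.sum_filter, ← (finTwoArrowEquiv Y).symm.sum_comp, Fintype.sum_prod_type,
    Finset.sum_eq_single y (by simp +contextual) (by simp)] at this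
  have h0 : ∀ a b : Y, (finTwoArrowEquiv Y).symm (a, b) 0 = a := fun _ _ => rfl
  simp [e1, h0] at this
  rw [← this, fiber, Finset.sum_filter]

theorem sum_fiber_sum (κ : Y → X) (f : Y → ℝ) : ∑ x, ∑ y ∈ fiber κ x, f y = ∑ y, f y := by
  simp only [fiber]
  exact Finset.sum_fiberwise _ _ _

theorem HasBlockSums.sum_row {κ : Y → X} {P : Matrix Y Y ℝ} {Q : Matrix X X ℝ}
    (h : HasBlockSums κ P Q) (y : Y) : ∑ x, Q (κ y) x = ∑ y', P y y' := by
  simp only [← h y, sum_fiber_sum]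

theorem HasBlockSums.isLumpable {κ : Y → X} (hκ : Function.Surjective κ) {P : Matrix Y Y ℝ}
    {Q : Matrix X X ℝ} (h : HasBlockSums κ P Q) (hP : P ∈ Matrix.rowStochastic ℝ Y) :
    IsLumpable κ P := by
  rw [Matrix.mem_rowStochastic_iff_sum] at hP
  refine ⟨Q, ?_, fun μ _ n x => lumpedPathProb_eq h μ x⟩
  rw [Matrix.mem_rowStochastic_iff_sum]
  constructor
  · intro x x'
    obtain ⟨y, rfl⟩ := hκ x
    rw [← h]
    exact Finset.sum_nonneg fun _ _ => hP.1 _ _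
  · intro x
    obtain ⟨y, rfl⟩ := hκ x
    rw [h.sum_row, hP.2]

theorem mem_lumpableMatrices_iff {κ : Y → X} (hκ : Function.Surjective κ) {E : Finset (Y × Y)}
    {P : Matrix Y Y ℝ} : P ∈ lumpableMatrices κ E ↔
      P ∈ stochasticMatrices E ∧ ∃ Q : Matrix X X ℝ, HasBlockSums κ P Q :=
  ⟨fun h => ⟨h.1, h.2.exists_hasBlockSums⟩, fun h => ⟨h.1, h.2.elim fun _ hQ =>
    hQ.isLumpable hκ h.1.1⟩⟩

/-! ### Logarithms of normalized matrices and the shift space -/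

/-- The entrywise logarithm of a matrix, restricted to the edge set. -/
noncomputable def edgeLog (E : Finset (Y × Y)) (P : Matrix Y Y ℝ) : EdgeFun E :=
  fun e => Real.log (P e.1.1 e.1.2)

/-- Taking the logarithm of the normalization adds log v(y') - log v(y) - log ρ to `H`. -/
theorem edgeLog_sNormalize_sub_mem {E : Finset (Y × Y)} {H : EdgeFun E}
    (hs : sNormalize (expMatrix E H) ∈ stochasticMatrices E) :
    edgeLog E (sNormalize (expMatrix E H)) - H ∈ shiftSpace E := by
  by_cases h : ∃ p : ℝ × (Y → ℝ), IsPFPair (expMatrix E H) p.1 p.2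
  · have hpos := hs.2
    have hv := h.choose_spec.pos
    have hN : sNormalize (expMatrix E H) = fun y y' =>
        expMatrix E H y y' * h.choose.2 y' / (h.choose.1 * h.choose.2 y) := dif_pos h
    rw [hN] at hpos ⊢
    refine ⟨-Real.log h.choose.1, fun y => Real.log (h.choose.2 y), fun e => ?_⟩
    obtain ⟨⟨y, y'⟩, he⟩ := e
    have h1 := (hpos y y').2 he
    have h2 : expMatrix E H y y' = Real.exp (H ⟨(y, y'), he⟩) := by simp [expMatrix, he]
    beta_reduce at h1
    rw [h2] at h1
    have hρ : 0 < h.choose.1 := by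
      by_contra hle
      exact absurd h1 (not_lt.2 (div_nonpos_of_nonneg_of_nonpos
        (mul_pos (Real.exp_pos _) (hv y')).le
        (mul_nonpos_of_nonpos_of_nonneg (not_lt.1 hle) (hv y).le)))
    simp only [edgeLog, Pi.sub_apply, h2]
    rw [Real.log_div (mul_pos (Real.exp_pos _) (hv y')).ne' (mul_pos hρ (hv y)).ne',
      Real.log_mul (Real.exp_pos _).ne' (hv y').ne', Real.log_mul hρ.ne' (hv y).ne', Real.log_exp]
    ring
  -- The default value `0` has no positive entry, so it lies in W(Y, E) only if there are no edges.
  · have hE : IsEmpty E := ⟨fun e => by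
      have := (hs.2 e.1.1 e.1.2).2 e.2
      rw [show sNormalize (expMatrix E H) = 0 from dif_neg h] at this
      exact lt_irrefl _ this⟩
    rw [Subsingleton.elim (edgeLog E (sNormalize (expMatrix E H)) - H) 0]
    exact zero_mem _

theorem finrank_shiftSpace_le [Nonempty Y] (E : Finset (Y × Y)) :
    Module.finrank ℝ (shiftSpace E) ≤ Fintype.card Y := by
  let y₀ : Y := Classical.arbitrary Y
  -- Normalizing f(y₀) = 0 frees the coordinate at `y₀` to store the constant c; this saves one
  -- dimension.
  let L : (Y → ℝ) →ₗ[ℝ] EdgeFun E :=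
    { toFun := fun g e => (if e.1.2 = y₀ then 0 else g e.1.2) -
        (if e.1.1 = y₀ then 0 else g e.1.1) + g y₀
      map_add' := fun g g' => by
        ext e; simp only [Pi.add_apply]; split_ifs <;> ring
      map_smul' := fun r g => by
        ext e; simp only [Pi.smul_apply, smul_eq_mul, RingHom.id_apply]; split_ifs <;> ring }
  have hL : shiftSpace E ≤ LinearMap.range L := by
    rintro N ⟨c, f, hf⟩
    refine ⟨fun y => if y = y₀ then c else f y - f y₀, ?_⟩
    ext e
    simp only [L, LinearMap.coe_mk, AddHom.coe_mk, hf, if_true]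
    split_ifs with h1 h2 h2 <;> simp [h1, h2]
  calc Module.finrank ℝ (shiftSpace E) ≤ Module.finrank ℝ (LinearMap.range L) :=
        Submodule.finrank_mono hL
    _ ≤ Module.finrank ℝ (Y → ℝ) := LinearMap.finrank_range_le L
    _ = Fintype.card Y := Module.finrank_fintype_fun_eq_card ℝ

/-! ### Two tools from linear algebra -/

theorem mem_of_log_smul_add_mem {M : Type*} [AddCommGroup M] [Module ℝ M] {W : Submodule ℝ M}
    {u₁ u₂ : M} {q₁ q₂ : ℝ} (hq₁ : 0 < q₁) (hq₂ : 0 < q₂)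
    (h : ∀ r₁ r₂ : ℝ, 0 < r₁ → 0 < r₂ → r₁ * q₁ + r₂ * q₂ = q₁ + q₂ →
      Real.log r₁ • u₁ + Real.log r₂ • u₂ ∈ W) : u₁ ∈ W := by
  have key : ∀ a b : ℝ, 0 < a → 0 < b → a + b = 1 →
      (Real.log a + Real.log ((q₁ + q₂) / q₁)) • u₁ +
        (Real.log b + Real.log ((q₁ + q₂) / q₂)) • u₂ ∈ W := by
    intro a b ha hb hab
    have h1 : 0 < (q₁ + q₂) / q₁ := by positivity
    have h2 : 0 < (q₁ + q₂) / q₂ := by positivity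
    rw [← Real.log_mul ha.ne' h1.ne', ← Real.log_mul hb.ne' h2.ne']
    refine h _ _ (by positivity) (by positivity) ?_
    field_simp
    rw [hab]
  -- Differences of three sample points cancel the unknown offsets. The coefficient vectors (-log 2,
  -- log (3/2)) and (log (3/2), -log 2) that remain are independent, so `u₂` can be eliminated.
  have hA := key (1 / 2) (1 / 2) (by norm_num) (by norm_num) (by norm_num)
  have hB := key (1 / 4) (3 / 4) (by norm_num) (by norm_num) (by norm_num)
  have hC := key (3 / 4) (1 / 4) (by norm_num) (by norm_num) (by norm_num)
  have l1 : Real.log (1 / 4) = Real.log (1 / 2) - Real.log 2 := by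
    rw [← Real.log_div (by norm_num) (by norm_num)]; norm_num
  have l2 : Real.log (3 / 4) = Real.log (1 / 2) + Real.log (3 / 2) := by
    rw [← Real.log_mul (by norm_num) (by norm_num)]; norm_num
  rw [l1, l2] at hB hC
  have hD := W.sub_mem (W.smul_mem (-Real.log 2) (W.sub_mem hB hA))
    (W.smul_mem (Real.log (3 / 2)) (W.sub_mem hC hA))
  have hne : (Real.log 2 - Real.log (3 / 2)) * (Real.log 2 + Real.log (3 / 2)) ≠ 0 := by
    have p1 : 0 < Real.log (3 / 2) := Real.log_pos (by norm_num)
    have p2 : Real.log (3 / 2) < Real.log 2 := Real.log_lt_log (by norm_num) (by norm_num)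
    exact (mul_pos (by linarith) (by linarith)).ne'
  rw [← W.smul_mem_iff hne]
  convert hD using 1
  module

/-- The system, completed by prescribing f on `S`, is square. Its homogeneous solutions vanish on
`S` and, backwards along paths into `S`, everywhere; so it is solvable. -/
theorem exists_potential {r : X → X → Prop} (hr : ∀ a b, Relation.ReflTransGen r a b)
    {s : X → X} {S : Set X} (hS : S.Nonempty) (hs : ∀ x ∉ S, ∀ x', r x x' → x' = s x)
    (h : X → ℝ) : ∃ f : X → ℝ, ∀ x ∉ S, f (s x) - f x = h x := by
  classical
  obtain ⟨z, hz⟩ := hS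
  let L : (X → ℝ) →ₗ[ℝ] (X → ℝ) :=
    { toFun := fun f x => if x ∈ S then f x else f (s x) - f x
      map_add' := fun f g => by
        ext x; simp only [Pi.add_apply]; split_ifs <;> ring
      map_smul' := fun c f => by
        ext x; simp only [Pi.smul_apply, smul_eq_mul, RingHom.id_apply]; split_ifs <;> ring }
  have hL : Function.Injective L := by
    rw [injective_iff_map_eq_zero]
    intro f hf
    have h1 : ∀ x, (if x ∈ S then f x else f (s x) - f x) = 0 := fun x => congrFun hf x
    refine funext fun x => ?_
    induction hr x z using Relation.ReflTransGen.head_induction_on with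
    | refl => simpa [hz] using h1 z
    | @head a b hab _ ih =>
      by_cases ha : a ∈ S
      · simpa [ha] using h1 a
      · have h2 := h1 a
        rw [if_neg ha, ← hs a ha b hab, ih] at h2
        simpa using h2
  obtain ⟨f, hf⟩ := LinearMap.injective_iff_surjective.1 hL h
  refine ⟨f, fun x hx => ?_⟩
  rw [← hf]
  simp [L, hx]

/-! ### Supports of lumpable matrices -/

theorem mem_lumpedEdges {κ : Y → X} {E : Finset (Y × Y)} {x x' : X} :
    (x, x') ∈ lumpedEdges κ E ↔ ∃ y y', (y, y') ∈ E ∧ κ y = x ∧ κ y' = x' := by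
  simp [lumpedEdges]

theorem stochasticMatrices_nonneg {E : Finset (Y × Y)} {P : Matrix Y Y ℝ}
    (hP : P ∈ stochasticMatrices E) (y y' : Y) : 0 ≤ P y y' :=
  (Matrix.mem_rowStochastic_iff_sum.1 hP.1).1 y y'

theorem stochasticMatrices_sum {E : Finset (Y × Y)} {P : Matrix Y Y ℝ}
    (hP : P ∈ stochasticMatrices E) (y : Y) : ∑ y', P y y' = 1 :=
  (Matrix.mem_rowStochastic_iff_sum.1 hP.1).2 y

theorem HasBlockSums.pos_iff {κ : Y → X} {E : Finset (Y × Y)} {P : Matrix Y Y ℝ}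
    {Q : Matrix X X ℝ} (h : HasBlockSums κ P Q) (hP : P ∈ stochasticMatrices E) (y : Y) (x' : X) :
    0 < Q (κ y) x' ↔ ∃ y', κ y' = x' ∧ (y, y') ∈ E := by
  rw [← h, Finset.sum_pos_iff_of_nonneg fun _ _ => stochasticMatrices_nonneg hP _ _]
  simp only [mem_fiber, hP.2]

theorem HasBlockSums.pos_iff_mem {κ : Y → X} (hκ : Function.Surjective κ) {E : Finset (Y × Y)}
    {P : Matrix Y Y ℝ} {Q : Matrix X X ℝ} (h : HasBlockSums κ P Q)
    (hP : P ∈ stochasticMatrices E) (x x' : X) : 0 < Q x x' ↔ (x, x') ∈ lumpedEdges κ E := by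
  rw [mem_lumpedEdges]
  constructor
  · intro hQ
    obtain ⟨y, rfl⟩ := hκ x
    obtain ⟨y', h1, h2⟩ := (h.pos_iff hP y x').1 hQ
    exact ⟨y, y', h2, rfl, h1⟩
  · rintro ⟨y, y', h1, rfl, rfl⟩
    exact (h.pos_iff hP y _).2 ⟨y', rfl, h1⟩

theorem exists_edge_of_mem_lumpedEdges {κ : Y → X} (hκ : Function.Surjective κ)
    {E : Finset (Y × Y)} {P : Matrix Y Y ℝ} (hP : P ∈ lumpableMatrices κ E) {y : Y} {x' : X}
    (h : (κ y, x') ∈ lumpedEdges κ E) : ∃ y', κ y' = x' ∧ (y, y') ∈ E := by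
  obtain ⟨hP, Q, hQ⟩ := (mem_lumpableMatrices_iff hκ).1 hP
  exact (hQ.pos_iff hP y x').1 ((hQ.pos_iff_mem hκ hP _ _).2 h)

theorem exists_mem_lumpedEdges {κ : Y → X} (hκ : Function.Surjective κ)
    {E : Finset (Y × Y)} {P : Matrix Y Y ℝ} (hP : P ∈ stochasticMatrices E) (x : X) :
    ∃ x', (x, x') ∈ lumpedEdges κ E := by
  obtain ⟨y, rfl⟩ := hκ x
  have h : 0 < ∑ y', P y y' := by rw [stochasticMatrices_sum hP]; exact one_pos
  obtain ⟨y', -, hy'⟩ := Finset.exists_lt_of_sum_lt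
    (show ∑ y' : Y, (0 : ℝ) < ∑ y', P y y' by simpa using h)
  exact ⟨κ y', mem_lumpedEdges.2 ⟨y, y', (hP.2 _ _).1 hy', rfl, rfl⟩⟩

/-! ### Indicators contained in the span of log-differences -/

/-- `W` contains the linear hull of the differences of logarithms of `κ`-lumpable matrices. -/
def ContainsLogDifferences (κ : Y → X) (E : Finset (Y × Y)) (W : Submodule ℝ (EdgeFun E)) : Prop :=
  ∀ P ∈ lumpableMatrices κ E, ∀ P' ∈ lumpableMatrices κ E, edgeLog E P' - edgeLog E P ∈ W

open Classical in
/-- The matrix with entries `r₁` on `p₁`, `r₂` on `p₂` and `1` elsewhere, for disjoint `p₁`, `p₂`. -/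
noncomputable def rescaling {Z : Type*} (p₁ p₂ : Z → Z → Prop) (r₁ r₂ : ℝ) (a b : Z) : ℝ :=
  1 + (if p₁ a b then r₁ - 1 else 0) + (if p₂ a b then r₂ - 1 else 0)

-- The log-difference between `P` and its rescaling is log r₁ times one indicator plus log r₂ times
-- the other. Varying r₁, r₂ under conservation of mass, `mem_of_log_smul_add_mem` isolates the
-- first.
open Classical in
theorem indicator_mem {κ : Y → X} (hκ : Function.Surjective κ) {E : Finset (Y × Y)}
    {W : Submodule ℝ (EdgeFun E)} (hW : ContainsLogDifferences κ E W) {P : Matrix Y Y ℝ}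
    (hP : P ∈ lumpableMatrices κ E) {p₁ p₂ : Y → Y → Prop} (hp : ∀ a b, p₁ a b → ¬ p₂ a b)
    {q₁ q₂ : ℝ} (hq₁ : 0 < q₁) (hq₂ : 0 < q₂)
    (h : ∀ r₁ r₂ : ℝ, r₁ * q₁ + r₂ * q₂ = q₁ + q₂ → ∃ Q' : Matrix X X ℝ,
      HasBlockSums κ (fun a b => P a b * rescaling p₁ p₂ r₁ r₂ a b) Q' ∧ ∀ x, ∑ x', Q' x x' = 1) :
    (fun e => if p₁ e.1.1 e.1.2 then 1 else 0 : EdgeFun E) ∈ W := by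
  refine mem_of_log_smul_add_mem (u₂ := fun e => if p₂ e.1.1 e.1.2 then 1 else 0) hq₁ hq₂ ?_
  intro r₁ r₂ hr₁ hr₂ hr
  obtain ⟨Q', hQ', hrow⟩ := h r₁ r₂ hr
  have hpos : ∀ a b, 0 < rescaling p₁ p₂ r₁ r₂ a b := by
    intro a b
    unfold rescaling
    have := hp a b
    split_ifs <;> first | (exfalso; tauto) | linarith
  have hP' : (fun a b => P a b * rescaling p₁ p₂ r₁ r₂ a b : Matrix Y Y ℝ) ∈
      lumpableMatrices κ E := by
    refine (mem_lumpableMatrices_iff hκ).2 ⟨⟨Matrix.mem_rowStochastic_iff_sum.2 ⟨fun a b => ?_,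
      fun a => ?_⟩, fun a b => ?_⟩, Q', hQ'⟩
    · exact mul_nonneg (stochasticMatrices_nonneg hP.1 a b) (hpos a b).le
    · rw [← hQ'.sum_row, hrow]
    · rw [← hP.1.2]
      exact mul_pos_iff_of_pos_right (hpos a b)
  convert hW P hP _ hP' using 1
  ext e
  have hPe := (hP.1.2 e.1.1 e.1.2).2 e.2
  simp only [edgeLog, Pi.add_apply, Pi.smul_apply, Pi.sub_apply, smul_eq_mul]
  rw [Real.log_mul hPe.ne' (hpos _ _).ne', add_sub_cancel_left, rescaling]
  have := hp e.1.1 e.1.2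
  split_ifs <;> first | (exfalso; tauto) | simp

theorem single_mem_of_two_edges {κ : Y → X} (hκ : Function.Surjective κ) {E : Finset (Y × Y)}
    {W : Submodule ℝ (EdgeFun E)} (hW : ContainsLogDifferences κ E W)
    (hne : (lumpableMatrices κ E).Nonempty) {y y₁ y₂ : Y} (h₁ : (y, y₁) ∈ E) (h₂ : (y, y₂) ∈ E)
    (hy : y₁ ≠ y₂) (hκy : κ y₁ = κ y₂) :
    (Pi.single ⟨(y, y₁), h₁⟩ 1 : EdgeFun E) ∈ W := by
  classical
  obtain ⟨P, hP⟩ := hne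
  obtain ⟨hPs, Q, hQ⟩ := (mem_lumpableMatrices_iff hκ).1 hP
  have := indicator_mem hκ hW hP (p₁ := fun a b => a = y ∧ b = y₁)
    (p₂ := fun a b => a = y ∧ b = y₂) (fun a b h h' => hy (h.2.symm.trans h'.2))
    ((hPs.2 _ _).2 h₁) ((hPs.2 _ _).2 h₂) (fun r₁ r₂ hr => ⟨Q, fun a x' => ?_, fun x => ?_⟩)
  · convert this using 1
    ext ⟨⟨a, b⟩, he⟩
    simp [Pi.single_apply, Subtype.ext_iff]
  · rw [← hQ]
    simp only [rescaling, mul_add, mul_one, Finset.sum_add_distrib, add_assoc]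
    rw [add_eq_left]
    by_cases ha : a = y
    · subst ha
      simp only [true_and, mul_ite, mul_zero, Finset.sum_ite_eq', mem_fiber, hκy]
      split_ifs
      · linarith
      · ring
    · simp [ha]
  · obtain ⟨y, rfl⟩ := hκ x
    rw [hQ.sum_row, stochasticMatrices_sum hPs]

/-- The indicator function of the edges of a block. -/
def blockIndicator (κ : Y → X) (E : Finset (Y × Y)) (x x' : X) : EdgeFun E :=
  fun e => if κ e.1.1 = x ∧ κ e.1.2 = x' then 1 else 0

theorem blockIndicator_eq_zero {κ : Y → X} {E : Finset (Y × Y)} {x x' : X}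
    (h : (x, x') ∉ lumpedEdges κ E) : blockIndicator κ E x x' = 0 := by
  ext e
  exact if_neg fun he => h (mem_lumpedEdges.2 ⟨_, _, e.2, he.1, he.2⟩)

theorem sum_smul_blockIndicator (κ : Y → X) (E : Finset (Y × Y)) (β : X → X → ℝ) (e : E) :
    (∑ x, ∑ x', β x x' • blockIndicator κ E x x') e = β (κ e.1.1) (κ e.1.2) := by
  simp [blockIndicator, Finset.sum_apply, ite_and, Finset.sum_ite_irrel]

theorem blockIndicator_mem_of_branching {κ : Y → X} (hκ : Function.Surjective κ)
    {E : Finset (Y × Y)} {W : Submodule ℝ (EdgeFun E)} (hW : ContainsLogDifferences κ E W)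
    (hne : (lumpableMatrices κ E).Nonempty) {x x₁ x₂ : X} (h₁ : (x, x₁) ∈ lumpedEdges κ E)
    (h₂ : (x, x₂) ∈ lumpedEdges κ E) (hx : x₁ ≠ x₂) : blockIndicator κ E x x₁ ∈ W := by
  classical
  obtain ⟨P, hP⟩ := hne
  obtain ⟨hPs, Q, hQ⟩ := (mem_lumpableMatrices_iff hκ).1 hP
  have := indicator_mem hκ hW hP (p₁ := fun a b => κ a = x ∧ κ b = x₁)
    (p₂ := fun a b => κ a = x ∧ κ b = x₂) (fun a b h h' => hx (h.2.symm.trans h'.2))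
    ((hQ.pos_iff_mem hκ hPs _ _).2 h₁) ((hQ.pos_iff_mem hκ hPs _ _).2 h₂) (fun r₁ r₂ hr =>
      ⟨fun a b => Q a b * rescaling (fun a b => a = x ∧ b = x₁) (fun a b => a = x ∧ b = x₂)
        r₁ r₂ a b, fun a x' => ?_, fun a => ?_⟩)
  · convert this using 1
    ext e
    simp [blockIndicator]
  · beta_reduce
    rw [← hQ, Finset.sum_mul]
    refine Finset.sum_congr rfl fun b hb => ?_
    rw [← mem_fiber.1 hb]
    rfl
  · have h1 : ∑ b, Q a b = 1 := by
      obtain ⟨y, rfl⟩ := hκ a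
      rw [hQ.sum_row, stochasticMatrices_sum hPs]
    simp only [rescaling, mul_add, mul_one, Finset.sum_add_distrib, add_assoc, h1]
    rw [add_eq_left]
    by_cases ha : a = x
    · subst ha
      simp only [true_and, mul_ite, mul_zero, Finset.sum_ite_eq', Finset.mem_univ, if_true]
      linarith
    · simp [ha]

theorem sum_shift_smul_blockIndicator_mem (κ : Y → X) {E : Finset (Y × Y)}
    {W : Submodule ℝ (EdgeFun E)} (hN : shiftSpace E ≤ W) (f : X → ℝ) (c : ℝ) :
    ∑ x, ∑ x', (f x' - f x + c) • blockIndicator κ E x x' ∈ W :=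
  hN ⟨c, f ∘ κ, fun e => by rw [sum_smul_blockIndicator]; rfl⟩

theorem lumpedEdges_stronglyConnected {κ : Y → X} (hκ : Function.Surjective κ)
    {E : Finset (Y × Y)} (hE : StronglyConnected E) (x x' : X) :
    Relation.ReflTransGen (fun a b => (a, b) ∈ lumpedEdges κ E) x x' := by
  obtain ⟨y, rfl⟩ := hκ x
  obtain ⟨y', rfl⟩ := hκ x'
  exact (hE y y').lift κ fun a b h => mem_lumpedEdges.2 ⟨a, b, h, rfl, rfl⟩

/-- A lumped row with two successors is covered by moving mass between its blocks. A row with a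
single successor admits no such move; there a shift function is chosen whose coefficients vanish at
every other uncovered row. -/
theorem blockIndicator_mem {κ : Y → X} (hκ : Function.Surjective κ) {E : Finset (Y × Y)}
    (hE : StronglyConnected E) {W : Submodule ℝ (EdgeFun E)} (hW : ContainsLogDifferences κ E W)
    (hN : shiftSpace E ≤ W) (hne : (lumpableMatrices κ E).Nonempty) (x x' : X) :
    blockIndicator κ E x x' ∈ W := by
  classical
  have hconn := lumpedEdges_stronglyConnected hκ hE
  obtain ⟨P, hP⟩ := id hne
  choose s hs using exists_mem_lumpedEdges hκ hP.1
  let S : Set X := {x | ∀ x', blockIndicator κ E x x' ∈ W}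
  have huniq : ∀ x ∉ S, ∀ x', (x, x') ∈ lumpedEdges κ E → x' = s x := by
    intro x hx x' hx'
    by_contra hxs
    refine hx fun a => ?_
    by_cases ha : (x, a) ∈ lumpedEdges κ E
    · by_cases has : a = s x
      · exact blockIndicator_mem_of_branching hκ hW hne ha hx' (by rintro rfl; exact hxs has)
      · exact blockIndicator_mem_of_branching hκ hW hne ha (hs x) has
    · rw [blockIndicator_eq_zero ha]
      exact zero_mem _
  have hmemS : ∀ x, blockIndicator κ E x (s x) ∈ W → x ∈ S := by
    intro x hx
    by_contra hxS
    refine hxS fun a => ?_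
    by_cases ha : (x, a) ∈ lumpedEdges κ E
    · rwa [huniq x hxS a ha]
    · rw [blockIndicator_eq_zero ha]
      exact zero_mem _
  have hsum : ∀ (f : X → ℝ) (c : ℝ), ∑ x, (if x ∈ S then 0 else
      (f (s x) - f x + c) • blockIndicator κ E x (s x)) ∈ W := by
    intro f c
    have h1 := sum_shift_smul_blockIndicator_mem κ hN f c
    have h2 : ∑ x, (if x ∈ S then ∑ x', (f x' - f x + c) • blockIndicator κ E x x' else 0) ∈ W := by
      refine W.sum_mem fun x _ => ?_
      split_ifs with hx
      · exact W.sum_mem fun x' _ => W.smul_mem _ (hx x')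
      · exact W.zero_mem
    convert W.sub_mem h1 h2 using 1
    rw [← Finset.sum_sub_distrib]
    refine Finset.sum_congr rfl fun x _ => ?_
    split_ifs with hx
    · rw [sub_self]
    · rw [sub_zero, Finset.sum_eq_single (s x) _ (by simp)]
      intro a _ ha
      rw [blockIndicator_eq_zero fun h => ha (huniq x hx a h), smul_zero]
  -- If no row were covered, `s` would be the only successor everywhere. A potential rising by 1
  -- along `s` except at `x`, with c = -1, leaves only the term at `x`. Its coefficient must vanish,
  -- so f rises by 1 at every step, which is impossible at a maximum of f.
  have hSne : S.Nonempty := by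
    by_contra hS
    rw [Set.not_nonempty_iff_eq_empty] at hS
    obtain ⟨f, hf⟩ := exists_potential hconn (Set.singleton_nonempty x)
      (fun a _ => huniq a (by simp [hS])) (fun _ => (1 : ℝ))
    have h1 := hsum f (-1)
    rw [Finset.sum_eq_single x (fun a _ ha => by rw [hf a (by simpa using ha)]; simp) (by simp),
      if_neg (by simp [hS])] at h1
    have h2 : f (s x) - f x + -1 = 0 := by
      by_contra h2
      have := hmemS x ((W.smul_mem_iff h2).1 h1)
      simp [hS] at this
    have : Nonempty X := ⟨x⟩
    obtain ⟨m, hm⟩ := Finite.exists_max f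
    have h3 := hm (s m)
    by_cases hmx : m = x
    · subst hmx
      linarith
    · have := hf m (by simpa using hmx)
      linarith
  suffices h : x ∈ S from h x'
  by_contra hx
  -- Among the uncovered rows this potential has a nonzero increment only at `x`, so the shift
  -- function isolates that block.
  obtain ⟨f, hf⟩ := exists_potential hconn hSne huniq (Pi.single x (1 : ℝ))
  have h1 := hsum f 0
  rw [Finset.sum_eq_single x _ (by simp), if_neg hx, hf x hx] at h1
  · simp only [Pi.single_eq_same, add_zero, one_smul] at h1
    exact hx (hmemS x h1)
  · intro a _ ha
    split_ifs with haS
    · rfl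
    · simp [hf a haS, ha]

/-! ### Merging edges and the lower bound for the dimension -/

theorem mem_mergingEdges {κ : Y → X} {E : Finset (Y × Y)} {y y' : Y} :
    (y, y') ∈ mergingEdges κ E ↔ (y, y') ∈ E ∧ y ∈ mergingRows κ E (κ y, κ y') := by
  simp only [mergingEdges, mergingBlocks, Finset.mem_biUnion, Finset.mem_filter,
    Finset.mem_product, mem_fiber, Prod.exists]
  constructor
  · rintro ⟨a, b, -, ⟨h1, h2⟩, h3⟩
    have h4 : κ y = a := by
      simp only [mergingRows, Finset.mem_filter, mem_fiber] at h1
      exact h1.1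
    rw [h4, h2]
    exact ⟨h3, h1⟩
  · rintro ⟨h1, h2⟩
    exact ⟨κ y, κ y', ⟨mem_lumpedEdges.2 ⟨y, y', h1, rfl, rfl⟩,
      Finset.ne_empty_of_mem h2⟩, ⟨h2, rfl⟩, h1⟩

theorem single_mem_of_mem_mergingEdges {κ : Y → X} (hκ : Function.Surjective κ)
    {E : Finset (Y × Y)} {W : Submodule ℝ (EdgeFun E)} (hW : ContainsLogDifferences κ E W)
    (hne : (lumpableMatrices κ E).Nonempty) (e : E) (he : e.1 ∈ mergingEdges κ E) :
    (Pi.single e 1 : EdgeFun E) ∈ W := by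
  obtain ⟨⟨y, y'⟩, hyE⟩ := e
  have h := (mem_mergingEdges.1 he).2
  simp only [mergingRows, Finset.mem_filter, mem_fiber, true_and] at h
  obtain ⟨y₁, h₁, y₂, h₂, hy, e₁, e₂⟩ := h
  by_cases hy' : y' = y₁
  · exact single_mem_of_two_edges hκ hW hne hyE e₂ (hy' ▸ hy) h₂.symm
  · exact single_mem_of_two_edges hκ hW hne hyE e₁ hy' h₁.symm

theorem mem_of_eq_off_mergingEdges {κ : Y → X} (hκ : Function.Surjective κ) {E : Finset (Y × Y)}
    (hE : StronglyConnected E) {W : Submodule ℝ (EdgeFun E)} (hW : ContainsLogDifferences κ E W)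
    (hN : shiftSpace E ≤ W) (hne : (lumpableMatrices κ E).Nonempty) {g : EdgeFun E}
    {β : X → X → ℝ} (hg : ∀ e : E, e.1 ∉ mergingEdges κ E → g e = β (κ e.1.1) (κ e.1.2)) :
    g ∈ W := by
  have h1 : ∑ x, ∑ x', β x x' • blockIndicator κ E x x' ∈ W :=
    W.sum_mem fun x _ => W.sum_mem fun x' _ =>
      W.smul_mem _ (blockIndicator_mem hκ hE hW hN hne x x')
  rw [← W.sub_mem_iff_left h1, ← Finset.univ_sum_single (g - _)]
  refine W.sum_mem fun e _ => ?_
  by_cases he : e.1 ∈ mergingEdges κ E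
  · have h2 := W.smul_mem ((g - ∑ x, ∑ x', β x x' • blockIndicator κ E x x') e)
      (single_mem_of_mem_mergingEdges hκ hW hne e he)
    rwa [← Pi.single_smul, smul_eq_mul, mul_one] at h2
  · rw [Pi.sub_apply, sum_smul_blockIndicator, hg e he, sub_self, Pi.single_zero]
    exact W.zero_mem

/-- Functions that are arbitrary on merging edges and constant per block elsewhere lie in `W`. The
block constants are visible exactly on the blocks that have a non-merging row. -/
theorem card_le_finrank {κ : Y → X} (hκ : Function.Surjective κ) {E : Finset (Y × Y)}
    (hE : StronglyConnected E) {W : Submodule ℝ (EdgeFun E)} (hW : ContainsLogDifferences κ E W)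
    (hN : shiftSpace E ≤ W) (hne : (lumpableMatrices κ E).Nonempty) :
    (mergingEdges κ E).card + (nonFullyMergingBlocks κ E).card ≤ Module.finrank ℝ W := by
  let J : ((mergingEdges κ E → ℝ) × (nonFullyMergingBlocks κ E → ℝ)) →ₗ[ℝ] EdgeFun E :=
    { toFun := fun p e => if h : e.1 ∈ mergingEdges κ E then p.1 ⟨e.1, h⟩ else
        if h : (κ e.1.1, κ e.1.2) ∈ nonFullyMergingBlocks κ E then p.2 ⟨_, h⟩ else 0
      map_add' := fun p p' => by
        ext e; simp only [Prod.fst_add, Prod.snd_add, Pi.add_apply]; split_ifs <;> simp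
      map_smul' := fun c p => by
        ext e
        simp only [Prod.smul_fst, Prod.smul_snd, Pi.smul_apply, RingHom.id_apply]
        split_ifs <;> simp }
  have hJW : ∀ p, J p ∈ W := fun p =>
    mem_of_eq_off_mergingEdges hκ hE hW hN hne (β := fun x x' =>
      if h : (x, x') ∈ nonFullyMergingBlocks κ E then p.2 ⟨_, h⟩ else 0) fun e he => dif_neg he
  have hJ : Function.Injective (J.codRestrict W hJW) := by
    rw [injective_iff_map_eq_zero]
    intro p hp
    have h0 : ∀ e, J p e = 0 := fun e => congrFun (congrArg Subtype.val hp) e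
    refine Prod.ext (funext fun e => ?_) (funext fun b => ?_)
    · obtain ⟨⟨y, y'⟩, he⟩ := e
      simpa [J, he] using h0 ⟨(y, y'), (mem_mergingEdges.1 he).1⟩
    · obtain ⟨⟨x, x'⟩, hb⟩ := b
      obtain ⟨hbD, hbM⟩ := Finset.mem_filter.1 hb
      have hsub : mergingRows κ E (x, x') ⊆ fiber κ x := Finset.filter_subset _ _
      obtain ⟨y, hy, hyM⟩ := Finset.exists_of_ssubset (hsub.ssubset_of_ne hbM)
      obtain rfl := mem_fiber.1 hy
      obtain ⟨P, hP⟩ := hne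
      -- Lumpability makes every row of `S_x` meet the block, so the non-merging row carries an edge
      -- on which the block constant can be read.
      obtain ⟨y', rfl, hyE⟩ := exists_edge_of_mem_lumpedEdges hκ hP hbD
      have hR : (y, y') ∉ mergingEdges κ E := fun h => hyM (mem_mergingEdges.1 h).2
      simpa [J, hR, hb] using h0 ⟨(y, y'), hyE⟩
  simpa using LinearMap.finrank_le_finrank_of_injective hJ

/-! ### The affine description of lumpable matrices and the upper bound for the parameter dimension
-/

/-- The linear constraints on a pair `(A, B)` of functions on `E` and on the lumped edges: the
first component compares the block row sums of `A` with `B`, the second gives the row sums of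
`B`. -/
noncomputable def lumpingConstraints (κ : Y → X) (E : Finset (Y × Y)) :
    (EdgeFun E × (lumpedEdges κ E → ℝ)) →ₗ[ℝ]
      (((b : lumpedEdges κ E) × fiber κ b.1.1) → ℝ) × (X → ℝ) where
  toFun p := (fun r => ∑ e : E with e.1.1 = r.2.1 ∧ κ e.1.2 = r.1.1.2, p.1 e - p.2 r.1,
    fun x => ∑ b : lumpedEdges κ E with b.1.1 = x, p.2 b)
  map_add' p p' := by
    ext
    · simp only [Prod.fst_add, Prod.snd_add, Pi.add_apply, Finset.sum_add_distrib]; ring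
    · simp only [Prod.snd_add, Pi.add_apply, Finset.sum_add_distrib]
  map_smul' c p := by
    ext
    · simp only [Prod.smul_fst, Prod.smul_snd, Pi.smul_apply, smul_eq_mul, RingHom.id_apply,
        mul_sub, Finset.mul_sum]
    · simp only [Prod.smul_snd, Pi.smul_apply, smul_eq_mul, RingHom.id_apply, Finset.mul_sum]

/-- The restriction of `P` and `Q` to the edges and the lumped edges. -/
def restrictEdges (κ : Y → X) (E : Finset (Y × Y)) (P : Matrix Y Y ℝ) (Q : Matrix X X ℝ) :
    EdgeFun E × (lumpedEdges κ E → ℝ) :=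
  (fun e => P e.1.1 e.1.2, fun b => Q b.1.1 b.1.2)

theorem lumpingConstraints_restrictEdges {κ : Y → X} (hκ : Function.Surjective κ)
    {E : Finset (Y × Y)} {P : Matrix Y Y ℝ} {Q : Matrix X X ℝ} (hP : P ∈ stochasticMatrices E)
    (hQ : HasBlockSums κ P Q) :
    lumpingConstraints κ E (restrictEdges κ E P Q) = (0, 1) := by
  have hP0 : ∀ y y', (y, y') ∉ E → P y y' = 0 := fun y y' h =>
    le_antisymm (not_lt.1 fun h' => h ((hP.2 y y').1 h')) (stochasticMatrices_nonneg hP y y')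
  have hQ0 : ∀ x x', (x, x') ∉ lumpedEdges κ E → Q x x' = 0 := fun x x' h => by
    refine le_antisymm (not_lt.1 fun h' => h ((hQ.pos_iff_mem hκ hP x x').1 h')) ?_
    obtain ⟨y, rfl⟩ := hκ x
    rw [← hQ]
    exact Finset.sum_nonneg fun _ _ => stochasticMatrices_nonneg hP _ _
  refine Prod.ext (funext fun r => ?_) (funext fun x => ?_)
  · obtain ⟨⟨⟨x, x'⟩, hb⟩, ⟨y, hy⟩⟩ := r
    obtain rfl := mem_fiber.1 hy
    simp only [lumpingConstraints, restrictEdges, LinearMap.coe_mk, AddHom.coe_mk, Pi.zero_apply]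
    rw [sub_eq_zero, ← hQ, Finset.sum_filter,
      Finset.sum_coe_sort E (fun e => if e.1 = y ∧ κ e.2 = x' then P e.1 e.2 else 0),
      Finset.sum_subset (Finset.subset_univ E) (fun e _ he => by simp [hP0 _ _ he]),
      Fintype.sum_prod_type, fiber, Finset.sum_filter,
      Finset.sum_eq_single y (by simp +contextual) (by simp)]
    simp
  · simp only [lumpingConstraints, restrictEdges, LinearMap.coe_mk, AddHom.coe_mk, Pi.one_apply]
    rw [Finset.sum_filter,
      Finset.sum_coe_sort (lumpedEdges κ E) (fun b => if b.1 = x then Q b.1 b.2 else 0),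
      Finset.sum_subset (Finset.subset_univ (lumpedEdges κ E))
        (fun e _ he => by simp [hQ0 _ _ he]),
      Fintype.sum_prod_type, Finset.sum_eq_single x (by simp +contextual) (by simp)]
    obtain ⟨y, rfl⟩ := hκ x
    simp [hQ.sum_row, stochasticMatrices_sum hP]

/-- Each constraint owns an unknown: first one lumped edge per `x` fixes the row sum of B, then one
edge per row of a block fixes its block sum. -/
theorem lumpingConstraints_surjective {κ : Y → X} (hκ : Function.Surjective κ)
    {E : Finset (Y × Y)} (hne : (lumpableMatrices κ E).Nonempty) :
    Function.Surjective (lumpingConstraints κ E) := by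
  obtain ⟨P, hP⟩ := hne
  choose s hs using exists_mem_lumpedEdges hκ hP.1
  have hc : ∀ r : (b : lumpedEdges κ E) × fiber κ b.1.1,
      ∃ y', κ y' = r.1.1.2 ∧ (r.2.1, y') ∈ E := fun r =>
    exists_edge_of_mem_lumpedEdges hκ hP (by rw [mem_fiber.1 r.2.2]; exact r.1.2)
  choose c hcκ hcE using hc
  rintro ⟨u, w⟩
  have hD : ∀ e : E, (κ e.1.1, κ e.1.2) ∈ lumpedEdges κ E := fun e =>
    mem_lumpedEdges.2 ⟨_, _, e.2, rfl, rfl⟩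
  let row : E → (b : lumpedEdges κ E) × fiber κ b.1.1 := fun e =>
    ⟨⟨_, hD e⟩, ⟨e.1.1, mem_fiber.2 rfl⟩⟩
  let B : lumpedEdges κ E → ℝ := fun b => if b.1.2 = s b.1.1 then w b.1.1 else 0
  refine ⟨(fun e => if e.1.2 = c (row e) then u (row e) + B (row e).1 else 0, B), ?_⟩
  refine Prod.ext (funext fun r => ?_) (funext fun x => ?_)
  · simp only [lumpingConstraints, LinearMap.coe_mk, AddHom.coe_mk]
    have hrow : ∀ e : E, e.1.1 = r.2.1 ∧ κ e.1.2 = r.1.1.2 → row e = r := by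
      rintro ⟨⟨y, y'⟩, he⟩ ⟨h1, h2⟩
      obtain ⟨⟨⟨x, x'⟩, hb⟩, ⟨z, hz⟩⟩ := r
      simp only at h1 h2
      subst h1 h2
      obtain rfl := mem_fiber.1 hz
      rfl
    have hrE : (⟨(r.2.1, c r), hcE r⟩ : E) ∈
        Finset.univ.filter fun e : E => e.1.1 = r.2.1 ∧ κ e.1.2 = r.1.1.2 := by
      simp [hcκ r]
    rw [Finset.sum_eq_single_of_mem _ hrE]
    · rw [hrow ⟨(r.2.1, c r), hcE r⟩ ⟨rfl, hcκ r⟩, if_pos rfl, add_sub_cancel_right]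
    · intro e he hne
      rw [Finset.mem_filter] at he
      refine if_neg fun h => hne (Subtype.ext (Prod.ext he.2.1 ?_))
      rw [h, hrow e he.2]
  · simp only [lumpingConstraints, LinearMap.coe_mk, AddHom.coe_mk]
    have hx : (⟨(x, s x), hs x⟩ : lumpedEdges κ E) ∈
        Finset.univ.filter fun b : lumpedEdges κ E => b.1.1 = x := by simp
    rw [Finset.sum_eq_single_of_mem _ hx]
    · simp [B]
    · intro b hb hne
      rw [Finset.mem_filter] at hb
      refine if_neg fun h => hne (Subtype.ext (Prod.ext hb.2 ?_))
      rw [h, hb.2]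

theorem finrank_ker_lumpingConstraints {κ : Y → X} (hκ : Function.Surjective κ)
    {E : Finset (Y × Y)} (hne : (lumpableMatrices κ E).Nonempty) :
    Module.finrank ℝ (LinearMap.ker (lumpingConstraints κ E)) +
      ∑ b ∈ lumpedEdges κ E, (fiber κ b.1).card + Fintype.card X =
        E.card + (lumpedEdges κ E).card := by
  have h := (lumpingConstraints κ E).finrank_range_add_finrank_ker
  rw [LinearMap.range_eq_top.2 (lumpingConstraints_surjective hκ hne), finrank_top,
    Module.finrank_prod, Module.finrank_prod, Module.finrank_fintype_fun_eq_card,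
    Module.finrank_fintype_fun_eq_card, Module.finrank_fintype_fun_eq_card,
    Module.finrank_fintype_fun_eq_card, Fintype.card_sigma, Fintype.card_coe, Fintype.card_coe]
    at h
  simp only [Fintype.card_coe] at h
  rw [Finset.sum_coe_sort (lumpedEdges κ E) (fun b => (fiber κ b.1).card)] at h
  omega

theorem le_finrank_ker_lumpingConstraints {κ : Y → X} (hκ : Function.Surjective κ)
    {E : Finset (Y × Y)} {d : ℕ} (h : EdgeFun E →ₗ[ℝ] (Fin d → ℝ))
    (hsurj : ∀ θ, ∃ P ∈ lumpableMatrices κ E, h (edgeLog E P) = θ) :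
    d ≤ Module.finrank ℝ (LinearMap.ker (lumpingConstraints κ E)) := by
  obtain ⟨P₀, hP₀, -⟩ := hsurj 0
  obtain ⟨hP₀, Q₀, hQ₀⟩ := (mem_lumpableMatrices_iff hκ).1 hP₀
  let U : Set (LinearMap.ker (lumpingConstraints κ E)) :=
    {z | ∀ e : E, 0 < P₀ e.1.1 e.1.2 + z.1.1 e}
  let F : LinearMap.ker (lumpingConstraints κ E) → Fin d → ℝ := fun z =>
    h fun e => Real.log (P₀ e.1.1 e.1.2 + z.1.1 e)
  have hlin : ∀ e : E, ContDiff ℝ 1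
      fun z : LinearMap.ker (lumpingConstraints κ E) => P₀ e.1.1 e.1.2 + z.1.1 e := fun e =>
    contDiff_const.add ((LinearMap.proj e ∘ₗ LinearMap.fst ℝ _ _ ∘ₗ
      (LinearMap.ker (lumpingConstraints κ E)).subtype).toContinuousLinearMap.contDiff)
  have hF : ContDiffOn ℝ 1 F U :=
    h.toContinuousLinearMap.contDiff.comp_contDiffOn
      (contDiffOn_pi.2 fun e => (hlin e).contDiffOn.log fun z hz => (hz e).ne')
  have hU : Convex ℝ U := by
    intro z hz w hw a b ha hb hab e
    have h1 : P₀ e.1.1 e.1.2 + (a • z + b • w).1.1 e =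
        a * (P₀ e.1.1 e.1.2 + z.1.1 e) + b * (P₀ e.1.1 e.1.2 + w.1.1 e) := by
      simp only [Submodule.coe_add, Submodule.coe_smul, Prod.fst_add, Prod.smul_fst, Pi.add_apply,
        Pi.smul_apply, smul_eq_mul]
      linear_combination (-P₀ e.1.1 e.1.2) * hab
    rw [h1]
    have hz' := hz e
    have hw' := hw e
    rcases ha.eq_or_lt with rfl | ha
    · rw [zero_add] at hab
      simpa [hab] using hw'
    · exact add_pos_of_pos_of_nonneg (mul_pos ha hz') (mul_nonneg hb hw'.le)
  have himage : F '' U = Set.univ := by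
    refine Set.eq_univ_of_forall fun θ => ?_
    obtain ⟨P, hP, hθ⟩ := hsurj θ
    obtain ⟨hP, Q, hQ⟩ := (mem_lumpableMatrices_iff hκ).1 hP
    refine ⟨⟨restrictEdges κ E P Q - restrictEdges κ E P₀ Q₀, ?_⟩, fun e => ?_, ?_⟩
    · rw [LinearMap.mem_ker, map_sub, lumpingConstraints_restrictEdges hκ hP hQ,
        lumpingConstraints_restrictEdges hκ hP₀ hQ₀, sub_self]
    · simpa [restrictEdges] using (hP.2 e.1.1 e.1.2).2 e.2
    · rw [← hθ]
      simp only [F, restrictEdges, Prod.fst_sub, Pi.sub_apply, add_sub_cancel]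
      rfl
  -- A C¹ map on a convex set does not raise Hausdorff dimension.
  have hdim : (d : ENNReal) ≤ Module.finrank ℝ (LinearMap.ker (lumpingConstraints κ E)) := by
    rw [← Real.dimH_univ_pi_fin d, ← himage, ← Real.dimH_univ_eq_finrank]
    exact (hF.dimH_image_le hU subset_rfl).trans (dimH_mono (Set.subset_univ U))
  exact_mod_cast hdim

/-- A left inverse on the quotient by `N` yields a linear map that recovers θ and ignores the
Perron–Frobenius normalization. -/
theorem exists_linearMap_of_linearIndependent_mkQ {M : Type*} [AddCommGroup M] [Module ℝ M]
    {N : Submodule ℝ M} {d : ℕ} {G : Fin d → M} (hG : LinearIndependent ℝ fun i => N.mkQ (G i)) :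
    ∃ h : M →ₗ[ℝ] (Fin d → ℝ), (∀ m ∈ N, h m = 0) ∧
      ∀ θ : Fin d → ℝ, h (∑ i, θ i • G i) = θ := by
  obtain ⟨g, hg⟩ := LinearMap.exists_leftInverse_of_injective _
    (LinearMap.ker_eq_bot.2 hG.fintypeLinearCombination_injective)
  refine ⟨g ∘ₗ N.mkQ, fun m hm => ?_, fun θ => ?_⟩
  · simp [(Submodule.Quotient.mk_eq_zero N).2 hm]
  · have := LinearMap.congr_fun hg θ
    rw [LinearMap.comp_apply, map_sum]
    simpa only [map_smul, LinearMap.comp_apply, Fintype.linearCombination_apply,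
      LinearMap.id_apply] using this

end Lumping

/-! ### Comparison of the two bounds -/

theorem mainTheorem10 {Y X : Type*} [Fintype Y] [DecidableEq Y] [Fintype X] [DecidableEq X]
    (E : Finset (Y × Y)) (hE : Lumping.StronglyConnected E)
    (κ : Y → X) (hκ : Function.Surjective κ)
    (h : ((Lumping.lumpedEdges κ E).card - (Lumping.nonFullyMergingBlocks κ E).card : ℤ)
          + (Fintype.card Y - Fintype.card X : ℤ)
          + (E.card - (Lumping.mergingEdges κ E).card : ℤ)
        < ∑ b ∈ Lumping.lumpedEdges κ E, ((Lumping.fiber κ b.1).card : ℤ)) :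
    ¬ Lumping.IsEFamily E (Lumping.lumpableMatrices κ E) := by
  open Lumping in
  rintro ⟨hsub, d, K, G, hG, hV⟩
  have hmem : ∀ θ : Fin d → ℝ,
      sNormalize (expMatrix E (K + ∑ i, θ i • G i)) ∈ lumpableMatrices κ E := fun θ => by
    rw [hV]; exact ⟨θ, rfl⟩
  have hlog : ∀ θ : Fin d → ℝ, edgeLog E (sNormalize (expMatrix E (K + ∑ i, θ i • G i))) -
      (K + ∑ i, θ i • G i) ∈ shiftSpace E := fun θ =>
    edgeLog_sNormalize_sub_mem (hsub (hmem θ))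
  have hne : (lumpableMatrices κ E).Nonempty := ⟨_, hmem 0⟩
  have hY : Nonempty Y := by
    by_contra hY
    rw [not_nonempty_iff] at hY
    have hX : IsEmpty X := ⟨fun x => (hκ x).elim fun y _ => hY.elim y⟩
    have h1 : ∀ s : Finset (Y × Y), s = ∅ := fun s => Finset.eq_empty_of_isEmpty s
    have h2 : ∀ s : Finset (X × X), s = ∅ := fun s => Finset.eq_empty_of_isEmpty s
    simp [h1 E, h1 (mergingEdges κ _), h2 (lumpedEdges κ _), h2 (nonFullyMergingBlocks κ _)] at h
  obtain ⟨g, hgN, hgG⟩ := exists_linearMap_of_linearIndependent_mkQ hG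
  have hd : d ≤ Module.finrank ℝ (LinearMap.ker (lumpingConstraints κ E)) := by
    -- The parameter is shifted to compensate for the contribution `g K` of the base point.
    refine le_finrank_ker_lumpingConstraints hκ g fun θ => ⟨_, hmem (θ - g K), ?_⟩
    have h1 := hgN _ (hlog (θ - g K))
    rw [map_sub, map_add, hgG, sub_eq_zero] at h1
    rw [h1, add_sub_cancel]
  have hker := finrank_ker_lumpingConstraints hκ hne
  let W : Submodule ℝ (EdgeFun E) := Submodule.span ℝ (Set.range G) ⊔ shiftSpace E
  have hW : ContainsLogDifferences κ E W := by
    have hspan : ∀ θ : Fin d → ℝ, ∑ i, θ i • G i ∈ W := fun θ =>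
      Submodule.mem_sup_left (Submodule.sum_mem _ fun i _ =>
        Submodule.smul_mem _ _ (Submodule.subset_span ⟨i, rfl⟩))
    intro P hP P' hP'
    rw [hV] at hP hP'
    obtain ⟨θ, rfl⟩ := hP
    obtain ⟨θ', rfl⟩ := hP'
    have h1 := W.sub_mem (W.add_mem (Submodule.mem_sup_right (hlog θ')) (hspan θ'))
      (W.add_mem (Submodule.mem_sup_right (hlog θ)) (hspan θ))
    convert h1 using 1
    abel
  have hlow := card_le_finrank hκ hE hW le_sup_right hne
  have hup : Module.finrank ℝ W ≤ d + Fintype.card Y :=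
    (Submodule.finrank_add_le_finrank_add_finrank _ _).trans
      (add_le_add ((finrank_range_le_card G).trans_eq (Fintype.card_fin d))
        (finrank_shiftSpace_le E))
  push_cast [← Nat.cast_sum] at h
  omega
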